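/- Let $\mathbb F$ be a finite field with more than two elements. Consider the two-user wired vector broadcast channel $$Y_r(i)=h_{r1}(i)X_1(i)+h_{r2}(i)X_2(i),\qquad r\in\{1,2\},\ i=1,2,\dots,$$ over $\mathbb F$, in which the two transmitters cooperate to send two independent messages $W_1,W_2$, where $W_r$ is desired by receiver $r$. At each channel use the network is in one of four connectivity states. In every state the direct coefficients $h_{11},h_{22}$ are non-zero. In state $A$, of the two cross coefficients only $h_{12}$ is non-zero; in state $B$ only $h_{21}$ is non-zero; in state $C$ both are non-zero; in state $D$ both are zero. The state sequence is known to all transmitters and receivers, and state $S$ occupies a limiting fraction $\lambda_S$ of the time (so $\lambda_A+\lambda_B+\lambda_C+\lambda_D=1$). The values of the channel coefficients, which may change from one channel use to the next, are known to the receivers but not to the transmitters. A pair of rates $R_1,R_2\ge 0$ is achievable if for every $\varepsilon>0$ and all sufficiently large $n$ there is a code of block length $n$, with at least $|\mathbb F|^{nR_r}$ messages for receiver $r$ ($r=1,2$), whose average probability of error is at most $\varepsilon$ for every choice of coefficient values that is compatible with the state sequence. Thus rates are measured in units of $\log_2|\mathbb F|$ bits per channel use. If the channel is symmetric, that is, $\lambda_A=\lambda_B$,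 then its sum capacity, the supremum of $R_1+R_2$ over all achievable pairs, equals $$1+\lambda_A+\lambda_D.$$ -/

import Mathlib

open Filter Topology

namespace AltBC

/-- The four connectivity states of a network with two transmitters and two receivers.
The direct links are present in every state; the states differ in the cross links. -/
inductive State where
  /-- only the cross link from transmitter 2 to receiver 1 is present -/
  | A
  /-- only the cross link from transmitter 1 to receiver 2 is present -/
  | B
  /-- both cross links are present -/
  | C
  /-- no cross link is present -/
  | D
  deriving DecidableEq

/-- `Linked S r t`: in state `S` there is a link from transmitter `t` to receiver `r`
(index `0` stands for user 1, index `1` for user 2). -/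
def Linked (S : State) (r t : Fin 2) : Prop :=
  r = t ∨ (r = 0 ∧ t = 1 ∧ (S = State.A ∨ S = State.C))
    ∨ (r = 1 ∧ t = 0 ∧ (S = State.B ∨ S = State.C))

/-- The state sequence `s` spends the fraction `l` of the time in state `S`. -/
def HasFraction (s : ℕ → State) (S : State) (l : ℝ) : Prop :=
  Tendsto (fun n : ℕ => (((Finset.range n).filter (fun i => s i = S)).card : ℝ) / n)
    atTop (𝓝 l)

/-- Channel coefficients over `n` channel uses: `H i r t` is the coefficient from transmitter `t`
to receiver `r` at channel use `i`. -/
abbrev Coeffs (F : Type*) (n : ℕ) := Fin n → Matrix (Fin 2) (Fin 2) F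

/-- The coefficients `H` have the connectivity prescribed by the state sequence `s`:
a coefficient is non-zero exactly when its link is present. -/
def Coeffs.Conforms {F : Type*} [Field F] {n : ℕ} (H : Coeffs F n) (s : ℕ → State) : Prop :=
  ∀ (i : Fin n) (r t : Fin 2), H i r t ≠ 0 ↔ Linked (s i) r t

/-- The signal received by receiver `r` when the cooperating transmitters send `x`
(`x i t` is the symbol sent by transmitter `t` at channel use `i`). -/
def received {F : Type*} [Field F] {n : ℕ} (H : Coeffs F n) (x : Fin n → Fin 2 → F)
    (r : Fin 2) : Fin n → F :=
  fun i => ∑ t, H i r t * x i t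

/-- A code of block length `n` for the vector broadcast channel, with `M₁` messages for receiver 1
and `M₂` messages for receiver 2. The transmitters encode both messages jointly, without access to
the channel coefficients; the receivers know the coefficients. A code is chosen for a given
state sequence, so encoder and decoders may depend on the states. -/
structure Code (F : Type*) (n M₁ M₂ : ℕ) where
  enc : Fin M₁ → Fin M₂ → Fin n → Fin 2 → F
  dec₁ : Coeffs F n → (Fin n → F) → Fin M₁
  dec₂ : Coeffs F n → (Fin n → F) → Fin M₂

/-- The probability, for independent uniformly distributed messages, that at least one receiver
decodes its message incorrectly when the channel coefficients are `H`. -/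
noncomputable def Code.errorProb {F : Type*} [Field F] {n M₁ M₂ : ℕ} (c : Code F n M₁ M₂)
    (H : Coeffs F n) : ℝ :=
  ({w : Fin M₁ × Fin M₂ |
      c.dec₁ H (received H (c.enc w.1 w.2) 0) ≠ w.1 ∨
      c.dec₂ H (received H (c.enc w.1 w.2) 1) ≠ w.2}.ncard : ℝ) / ((M₁ : ℝ) * (M₂ : ℝ))

/-- The rate pair `(R₁, R₂)`, in units of `log₂ |F|` bits per channel use, is achievable over the
state sequence `s`: there are codes of all large block lengths `n` with at least `|F| ^ (n R₁)` and
`|F| ^ (n R₂)` messages, whose error probability tends to zero uniformly over all values of the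
channel coefficients that are compatible with the connectivity. -/
def Achievable (F : Type*) [Field F] [Fintype F] (s : ℕ → State) (R₁ R₂ : ℝ) : Prop :=
  0 ≤ R₁ ∧ 0 ≤ R₂ ∧ ∀ ε : ℝ, 0 < ε → ∀ᶠ n : ℕ in atTop,
    ∃ (M₁ M₂ : ℕ) (c : Code F n M₁ M₂),
      (Fintype.card F : ℝ) ^ ((n : ℝ) * R₁) ≤ M₁ ∧
      (Fintype.card F : ℝ) ^ ((n : ℝ) * R₂) ≤ M₂ ∧
      ∀ H : Coeffs F n, H.Conforms s → c.errorProb H ≤ ε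

/-- `C` is the sum capacity over the state sequence `s`: the supremum of the sum rates `R₁ + R₂`
of the achievable rate pairs. -/
def IsSumCapacity (F : Type*) [Field F] [Fintype F] (s : ℕ → State) (C : ℝ) : Prop :=
  IsLUB {R : ℝ | ∃ R₁ R₂ : ℝ, Achievable F s R₁ R₂ ∧ R = R₁ + R₂} C

end AltBC

/-!
The converse rests on Shannon entropies of functions on the set of message pairs. Write `X` for the
signal of receiver 2 outside state `B`, `Y` for the signal of receiver 1 outside state `A`, `m, m'`
for what receiver 2 sees in state `B` and `l, l'` for what receiver 1 sees in state `A` under two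
different values of the cross coefficient; two such values exist because the field has more than
two elements. One code has to work for both. Up to Fano terms, `(X, m)` and `(X, m')` both
determine `W₂`, so submodularity of entropy gives
`H(X, m, m', W₂) + H(X, W₂) ≤ 2 H(X) + H(m) + H(m')`, while
`H(X) + H(W₁, W₂) ≤ H(X, W₁) + H(X, W₂)`. Hence (`log_card_add_entropy_le`)
`H(W₁, W₂) + H(X, m, m', W₂) ≤ H(X) + H(m) + H(m') + H(X, W₁)`,
and likewise with the receivers exchanged. In state `C` both receivers may see the same signal, and
`l, l'` determine both inputs in state `A`, so `(Y, l, l', W₁)` determines `(X, W₁)` except for the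
signal of receiver 2 in state `D`. Adding the two bounds therefore leaves
`2 H(W₁, W₂) ≤ n (2 + λ_A + λ_B + 2 λ_D) log |F|` (`two_mul_log_card_le`, `Achievable.add_le`).

For achievability, each use in state `A` is paired with one in state `B`, and a pair carries three
symbols without error (`pairEnc`). For `λ_A = λ_B` the two bounds meet.
-/

namespace AltBC

/-! ### Entropy of a function on a finite uniform probability space -/

section Entropy

open Classical in
/-- The number of points of the fibre of `f` through `ω`. -/
noncomputable def fiberCard {Ω α : Type*} [Fintype Ω] (f : Ω → α) (ω : Ω) : ℕ :=
  (Finset.univ.filter (fun ω' => f ω' = f ω)).card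

/-- The Shannon entropy, in nats, of `f` regarded as a random variable on `Ω` with the uniform
distribution: the mean of `log (|Ω| / |fibre through ω|)`. As it depends on the fibres of `f` only,
it needs no structure on the codomain. -/
noncomputable def entropy {Ω α : Type*} [Fintype Ω] (f : Ω → α) : ℝ :=
  Real.log (Fintype.card Ω) - (∑ ω, Real.log (fiberCard f ω)) / Fintype.card Ω

variable {Ω α β γ : Type*} [Fintype Ω]

lemma fiberCard_pos (f : Ω → α) (ω : Ω) : 0 < fiberCard f ω := by
  classical
  exact Finset.card_pos.2 ⟨ω, by simp⟩

lemma fiberCard_congr (f : Ω → α) {ω ω' : Ω} (h : f ω = f ω') :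
    fiberCard f ω = fiberCard f ω' := by
  unfold fiberCard
  rw [h]

lemma entropy_le_of_factorsThrough {f : Ω → α} {g : Ω → β} (h : g.FactorsThrough f) :
    entropy g ≤ entropy f := by
  classical
  unfold entropy
  gcongr with ω
  · exact_mod_cast fiberCard_pos f ω
  · exact Finset.card_le_card fun ω' => by simpa using @h ω' ω

lemma entropy_nonneg [Nonempty Ω] (f : Ω → α) : 0 ≤ entropy f := by
  classical
  have h : ∑ ω, Real.log (fiberCard f ω) ≤ ∑ _ω : Ω, Real.log (Fintype.card Ω) := by
    gcongr with ω
    · exact_mod_cast fiberCard_pos f ω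
    · exact Finset.card_le_univ _
  rw [Finset.sum_const, Finset.card_univ, nsmul_eq_mul] at h
  have hpos : (0 : ℝ) < Fintype.card Ω := by exact_mod_cast Fintype.card_pos
  rw [entropy, sub_nonneg, div_le_iff₀ hpos]
  linarith

lemma entropy_of_injective {f : Ω → α} (hf : f.Injective) :
    entropy f = Real.log (Fintype.card Ω) := by
  classical
  have h : ∀ ω, fiberCard f ω = 1 := fun ω => by
    rw [fiberCard, Finset.card_eq_one]
    exact ⟨ω, by ext; simp [hf.eq_iff]⟩
  simp [entropy, h]

lemma sum_inv_fiberCard_le_one [DecidableEq α] (f : Ω → α) (a : α) :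
    ∑ ω with f ω = a, ((fiberCard f ω : ℝ))⁻¹ ≤ 1 := by
  have h : ∀ ω ∈ Finset.univ.filter (fun ω => f ω = a), ((fiberCard f ω : ℝ))⁻¹
      = ((Finset.univ.filter (fun ω => f ω = a)).card : ℝ)⁻¹ := by
    intro ω hω
    rw [Finset.mem_filter] at hω
    unfold fiberCard
    rw [hω.2]
    congr!
  rw [Finset.sum_congr rfl h, Finset.sum_const, nsmul_eq_mul]
  exact mul_inv_le_one

/-- **Gibbs' inequality**: entropy is at most the cross entropy relative to any sub-probability
weight. -/
lemma entropy_le_cross [Nonempty Ω] [Fintype α] (f : Ω → α) (q : α → ℝ) (hq : ∀ a, 0 < q a)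
    (hsum : ∑ a, q a ≤ 1) :
    entropy f ≤ (∑ ω, -Real.log (q (f ω))) / Fintype.card Ω := by
  classical
  have hpos : (0 : ℝ) < Fintype.card Ω := by exact_mod_cast Fintype.card_pos
  have hN : ∀ ω, (0 : ℝ) < fiberCard f ω := fun ω => by exact_mod_cast fiberCard_pos f ω
  have h1 : ∑ ω, q (f ω) * ((fiberCard f ω : ℝ))⁻¹ ≤ 1 := by
    rw [← Finset.sum_fiberwise Finset.univ f]
    refine (Finset.sum_le_sum fun a _ => ?_).trans hsum
    rw [Finset.sum_congr rfl (g := fun ω => q a * ((fiberCard f ω : ℝ))⁻¹)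
      (fun ω hω => by rw [(Finset.mem_filter.1 hω).2]), ← Finset.mul_sum]
    exact mul_le_of_le_one_right (hq a).le (sum_inv_fiberCard_le_one f a)
  have h2 : ∀ ω, Real.log (Fintype.card Ω) + Real.log (q (f ω)) - Real.log (fiberCard f ω)
      ≤ Fintype.card Ω * (q (f ω) * ((fiberCard f ω : ℝ))⁻¹) - 1 := by
    intro ω
    have := hq (f ω)
    have := hN ω
    have h := Real.log_le_sub_one_of_pos
      (show 0 < Fintype.card Ω * (q (f ω) * ((fiberCard f ω : ℝ))⁻¹) by positivity)
    rw [Real.log_mul (by positivity) (by positivity), Real.log_mul (by positivity) (by positivity),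
      Real.log_inv] at h
    linarith
  have h3 := Finset.sum_le_sum fun ω (_ : ω ∈ Finset.univ) => h2 ω
  simp only [Finset.sum_sub_distrib, Finset.sum_add_distrib, ← Finset.mul_sum, Finset.sum_const,
    Finset.card_univ, nsmul_eq_mul, mul_one] at h3
  have h4 := mul_le_mul_of_nonneg_left h1 hpos.le
  rw [entropy, sub_le_iff_le_add, ← add_div, le_div_iff₀ hpos, Finset.sum_neg_distrib]
  linarith

lemma entropy_le_log_card [Nonempty Ω] [Fintype α] (f : Ω → α) :
    entropy f ≤ Real.log (Fintype.card α) := by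
  have : Nonempty α := ⟨f (Classical.arbitrary Ω)⟩
  have hpos : (0 : ℝ) < Fintype.card α := by exact_mod_cast Fintype.card_pos
  have hΩ : (Fintype.card Ω : ℝ) ≠ 0 := by exact_mod_cast Fintype.card_ne_zero
  refine (entropy_le_cross f (fun _ => ((Fintype.card α : ℝ))⁻¹) (fun _ => by positivity)
    (by simp)).trans_eq ?_
  simp [Real.log_inv, hΩ]

/-- **Submodularity** of entropy: if `k` is a function of `p` and also a function of `q`, then
`H(p, q) + H(k) ≤ H(p) + H(q)`. -/
lemma entropy_submodular [Nonempty Ω] (p : Ω → α) (q : Ω → β) {k : Ω → γ}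
    (hp : k.FactorsThrough p) (hq : k.FactorsThrough q) :
    entropy (fun ω => (p ω, q ω)) + entropy k ≤ entropy p + entropy q := by
  classical
  set j : Ω → α × β := fun ω => (p ω, q ω) with hj
  have hpos : (0 : ℝ) < Fintype.card Ω := by exact_mod_cast Fintype.card_pos
  have hNγ : ∀ ω, (0 : ℝ) < fiberCard k ω := fun ω => by exact_mod_cast fiberCard_pos k ω
  have hNα : ∀ ω, (0 : ℝ) < fiberCard p ω := fun ω => by exact_mod_cast fiberCard_pos p ω
  have hNβ : ∀ ω, (0 : ℝ) < fiberCard q ω := fun ω => by exact_mod_cast fiberCard_pos q ω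
  have hNj : ∀ ω, (0 : ℝ) < fiberCard j ω := fun ω => by exact_mod_cast fiberCard_pos j ω
  -- Expand the numerator as a number of pairs `(ω₁, ω₂)` and sum over `ω` first: the inner sum
  -- runs over one fibre of `(p, q)`, and only pairs in a common fibre of `k` contribute.
  have h1 : ∑ ω, (fiberCard p ω : ℝ) * fiberCard q ω *
      (((fiberCard j ω : ℝ))⁻¹ * ((fiberCard k ω : ℝ))⁻¹) ≤ Fintype.card Ω := by
    calc _ = ∑ ω, ∑ ω₁, ∑ ω₂, (if p ω₁ = p ω then 1 else 0) * (if q ω₂ = q ω then 1 else 0) *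
          (((fiberCard j ω : ℝ))⁻¹ * ((fiberCard k ω : ℝ))⁻¹) := by
          refine Finset.sum_congr rfl fun ω _ => ?_
          simp_rw [← Finset.sum_mul, ← Finset.mul_sum, ← Finset.sum_mul]
          simp [fiberCard]
      _ = ∑ ω₁, ∑ ω₂, ∑ ω, (if p ω₁ = p ω then 1 else 0) * (if q ω₂ = q ω then 1 else 0) *
          (((fiberCard j ω : ℝ))⁻¹ * ((fiberCard k ω : ℝ))⁻¹) := by
          rw [Finset.sum_comm]
          exact Finset.sum_congr rfl fun _ _ => Finset.sum_comm
      _ ≤ ∑ ω₁, ∑ ω₂, (if k ω₂ = k ω₁ then ((fiberCard k ω₁ : ℝ))⁻¹ else 0) := by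
          refine Finset.sum_le_sum fun ω₁ _ => Finset.sum_le_sum fun ω₂ _ => ?_
          split_ifs with hk
          · calc _ = ∑ ω with j ω = (p ω₁, q ω₂),
                  ((fiberCard k ω₁ : ℝ))⁻¹ * ((fiberCard j ω : ℝ))⁻¹ := by
                  rw [Finset.sum_filter]
                  refine Finset.sum_congr rfl fun ω _ => ?_
                  by_cases h1 : p ω₁ = p ω <;> by_cases h2 : q ω₂ = q ω <;>
                    simp [hj, h1, h2, eq_comm]
                  rw [fiberCard_congr k (hp h1)]
                  ring
              _ ≤ _ := by
                  rw [← Finset.mul_sum]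
                  exact mul_le_of_le_one_right (inv_nonneg.2 (hNγ _).le)
                    (sum_inv_fiberCard_le_one j (p ω₁, q ω₂))
          · refine (Finset.sum_eq_zero fun ω _ => ?_).le
            by_cases h1 : p ω₁ = p ω <;> by_cases h2 : q ω₂ = q ω <;> simp [h1, h2]
            exact absurd ((hq h2).trans (hp h1).symm) hk
      _ = ∑ _ω₁ : Ω, (1 : ℝ) := by
          refine Finset.sum_congr rfl fun ω₁ _ => ?_
          rw [← Finset.sum_filter, Finset.sum_const, nsmul_eq_mul]
          exact mul_inv_cancel₀ (hNγ ω₁).ne'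
      _ = _ := by simp
  have h2 : ∀ ω, Real.log (fiberCard p ω) + Real.log (fiberCard q ω)
      - Real.log (fiberCard j ω) - Real.log (fiberCard k ω) ≤
      (fiberCard p ω : ℝ) * fiberCard q ω *
        (((fiberCard j ω : ℝ))⁻¹ * ((fiberCard k ω : ℝ))⁻¹) - 1 := by
    intro ω
    have := hNγ ω
    have := hNα ω
    have := hNβ ω
    have := hNj ω
    have h := Real.log_le_sub_one_of_pos (show 0 < (fiberCard p ω : ℝ) * fiberCard q ω *
      (((fiberCard j ω : ℝ))⁻¹ * ((fiberCard k ω : ℝ))⁻¹) by positivity)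
    rw [Real.log_mul (by positivity) (by positivity), Real.log_mul (by positivity) (by positivity),
      Real.log_mul (by positivity) (by positivity), Real.log_inv, Real.log_inv] at h
    linarith
  have h3 := Finset.sum_le_sum fun ω (_ : ω ∈ Finset.univ) => h2 ω
  simp only [Finset.sum_sub_distrib, Finset.sum_add_distrib, Finset.sum_const,
    Finset.card_univ, nsmul_eq_mul, mul_one] at h3
  have h4 : (∑ ω, Real.log (fiberCard p ω)) / Fintype.card Ω
      + (∑ ω, Real.log (fiberCard q ω)) / Fintype.card Ω
      ≤ (∑ ω, Real.log (fiberCard j ω)) / Fintype.card Ω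
      + (∑ ω, Real.log (fiberCard k ω)) / Fintype.card Ω := by
    rw [← add_div, ← add_div]
    exact div_le_div_of_nonneg_right (by linarith) hpos.le
  simp only [entropy]
  linarith

lemma entropy_prod_le [Nonempty Ω] (p : Ω → α) (q : Ω → β) :
    entropy (fun ω => (p ω, q ω)) ≤ entropy p + entropy q := by
  have h := entropy_submodular p q (k := fun _ => ()) (fun _ _ _ => rfl) (fun _ _ _ => rfl)
  linarith [entropy_nonneg (fun _ : Ω => ())]

open Classical in
/-- The error variable of a guess `g` for `W`: it is the correct value where the guess fails, and
`none` where it succeeds. The pair of the guess and this variable determines `W`. -/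
noncomputable def errorVar (W g : Ω → α) (ω : Ω) : Option α :=
  if g ω = W ω then none else some (W ω)

lemma eq_of_errorVar_eq {Ω α : Type*} {W g : Ω → α} {ω ω' : Ω} (hg : g ω = g ω')
    (h : errorVar W g ω = errorVar W g ω') : W ω = W ω' := by
  unfold errorVar at h
  split_ifs at h with h1 h2
  · rw [← h1, ← h2, hg]
  · simpa using h

/-- The quantitative part of **Fano's inequality**. -/
lemma entropy_errorVar_le [Nonempty Ω] [Fintype α] (W g : Ω → α) {ε : ℝ}
    (hε : ({ω | g ω ≠ W ω}.ncard : ℝ) / Fintype.card Ω ≤ ε) :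
    entropy (errorVar W g) ≤ Real.log 2 + ε * Real.log (Fintype.card α) := by
  classical
  have : Nonempty α := ⟨W (Classical.arbitrary Ω)⟩
  have hpos : (0 : ℝ) < Fintype.card α := by exact_mod_cast Fintype.card_pos
  have hΩ : (0 : ℝ) < Fintype.card Ω := by exact_mod_cast Fintype.card_pos
  -- Weight `1/2` on success, the other half spread evenly over the values of `W`.
  let q : Option α → ℝ := fun o => o.elim (1 / 2) fun _ => 1 / 2 * ((Fintype.card α : ℝ))⁻¹
  refine (entropy_le_cross (errorVar W g) q ?_ ?_).trans ?_
  · rintro (_ | a) <;> simp only [q, Option.elim] <;> positivity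
  · rw [Fintype.sum_option]
    simp only [q, Option.elim, Finset.sum_const, Finset.card_univ, nsmul_eq_mul]
    field_simp
    norm_num
  · have h : ∀ ω, -Real.log (q (errorVar W g ω))
        = Real.log 2 + (if g ω ≠ W ω then 1 else 0) * Real.log (Fintype.card α) := by
      intro ω
      by_cases hω : g ω = W ω
      · simp [errorVar, q, hω]
      · simp only [errorVar, q, hω, if_false, Option.elim, ne_eq, not_false_eq_true, if_true]
        rw [Real.log_mul (by norm_num) (by positivity), Real.log_inv, one_div, Real.log_inv]
        ring
    simp_rw [h]
    rw [Finset.sum_add_distrib, ← Finset.sum_mul, Finset.sum_boole, Finset.sum_const,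
      Finset.card_univ, nsmul_eq_mul, add_div, mul_div_cancel_left₀ _ hΩ.ne']
    rw [Set.ncard_eq_toFinset_card', Set.toFinset_ofPred] at hε
    rw [mul_div_right_comm]
    gcongr

end Entropy

/-! ### The converse -/

section Entropic

variable {Ω : Type*} [Fintype Ω] [Nonempty Ω]

/-- One of the two halves of the converse. The variable `X` stands for the part of the signal of one
receiver that does not depend on its coefficients, `m` and `m'` for the remaining part under two
choices of the coefficients; under either choice the receiver finds `W₂` up to an error variable.
Submodularity for the two choices bounds `H(X, m, m', W₂) + H(X, W₂)`, and submodularity for the two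
messages turns `H(X, W₂)` into `H(X) - H(X, W₁)` plus the entropy of all messages. -/
lemma log_card_add_entropy_le {α β W₁ W₂ κ κ' : Type*} {X : Ω → α} {m m' : Ω → β}
    {w₁ : Ω → W₁} {w₂ : Ω → W₂} {E : Ω → κ} {E' : Ω → κ'}
    (hw : Function.Injective fun ω => (w₁ ω, w₂ ω))
    (hE : w₂.FactorsThrough fun ω => ((X ω, m ω), E ω))
    (hE' : w₂.FactorsThrough fun ω => ((X ω, m' ω), E' ω)) :
    Real.log (Fintype.card Ω) + entropy (fun ω => (X ω, m ω, m' ω, w₂ ω)) ≤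
      entropy X + entropy m + entropy m' + entropy E + entropy E'
        + entropy (fun ω => (X ω, w₁ ω)) := by
  have h1 : entropy (fun ω => (X ω, m ω, w₂ ω)) ≤ entropy X + entropy m + entropy E := by
    refine (entropy_le_of_factorsThrough (f := fun ω => ((X ω, m ω), E ω)) ?_).trans
      ((entropy_prod_le _ E).trans (by gcongr; exact entropy_prod_le X m))
    intro ω ω' h
    have := hE h
    grind
  have h1' : entropy (fun ω => (X ω, m' ω, w₂ ω)) ≤ entropy X + entropy m' + entropy E' := by
    refine (entropy_le_of_factorsThrough (f := fun ω => ((X ω, m' ω), E' ω)) ?_).trans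
      ((entropy_prod_le _ E').trans (by gcongr; exact entropy_prod_le X m'))
    intro ω ω' h
    have := hE' h
    grind
  have h2 := entropy_submodular (fun ω => (X ω, m ω, w₂ ω)) (fun ω => (X ω, m' ω, w₂ ω))
    (k := fun ω => (X ω, w₂ ω)) (fun _ _ _ => by grind) (fun _ _ _ => by grind)
  have h3 : entropy (fun ω => (X ω, m ω, m' ω, w₂ ω)) ≤
      entropy (fun ω => ((X ω, m ω, w₂ ω), (X ω, m' ω, w₂ ω))) :=
    entropy_le_of_factorsThrough fun _ _ _ => by grind
  have h4 := entropy_submodular (fun ω => (X ω, w₁ ω)) (fun ω => (X ω, w₂ ω))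
    (k := X) (fun _ _ _ => by grind) (fun _ _ _ => by grind)
  have h5 : Real.log (Fintype.card Ω) ≤ entropy (fun ω => ((X ω, w₁ ω), (X ω, w₂ ω))) := by
    rw [← entropy_of_injective hw]
    exact entropy_le_of_factorsThrough fun _ _ _ => by grind
  linarith

/-- The two halves combined. What one receiver collects under its two choices of coefficients,
together with `d₂` or `d₁`, determines the coefficient-independent signal `X` or `Y` of the other
receiver. So the last term of each half is, up to the entropy of `d₂` or `d₁`, at most the joint
entropy on the left of the other half. -/
lemma two_mul_log_card_le {α₁ α₂ β₁ β₂ W₁ W₂ κ₁ κ₂ δ₁ δ₂ : Type*} {X : Ω → α₂} {Y : Ω → α₁}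
    {l l' : Ω → β₁} {m m' : Ω → β₂} {w₁ : Ω → W₁} {w₂ : Ω → W₂} {E₁ E₁' : Ω → κ₁}
    {E₂ E₂' : Ω → κ₂} (d₁ : Ω → δ₁) (d₂ : Ω → δ₂)
    (hw : Function.Injective fun ω => (w₁ ω, w₂ ω))
    (hE₁ : w₁.FactorsThrough fun ω => ((Y ω, l ω), E₁ ω))
    (hE₁' : w₁.FactorsThrough fun ω => ((Y ω, l' ω), E₁' ω))
    (hE₂ : w₂.FactorsThrough fun ω => ((X ω, m ω), E₂ ω))
    (hE₂' : w₂.FactorsThrough fun ω => ((X ω, m' ω), E₂' ω))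
    (hX : X.FactorsThrough fun ω => (Y ω, l ω, l' ω, d₂ ω))
    (hY : Y.FactorsThrough fun ω => (X ω, m ω, m' ω, d₁ ω)) :
    2 * Real.log (Fintype.card Ω) ≤ entropy X + entropy Y + (entropy m + entropy m')
      + (entropy l + entropy l') + (entropy d₁ + entropy d₂) + (entropy E₁ + entropy E₁')
      + (entropy E₂ + entropy E₂') := by
  have h1 := log_card_add_entropy_le hw hE₂ hE₂'
  have h2 := log_card_add_entropy_le (w₁ := w₂) (w₂ := w₁)
    (fun a b h => hw (by simp only [Prod.mk.injEq] at h ⊢; exact h.symm)) hE₁ hE₁'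
  have h3 : entropy (fun ω => (X ω, w₁ ω)) ≤
      entropy (fun ω => (Y ω, l ω, l' ω, w₁ ω)) + entropy d₂ := by
    refine (entropy_le_of_factorsThrough ?_).trans (entropy_prod_le _ d₂)
    intro ω ω' h
    have := @hX ω ω'
    grind
  have h4 : entropy (fun ω => (Y ω, w₂ ω)) ≤
      entropy (fun ω => (X ω, m ω, m' ω, w₂ ω)) + entropy d₁ := by
    refine (entropy_le_of_factorsThrough ?_).trans (entropy_prod_le _ d₁)
    intro ω ω' h
    have := @hY ω ω'
    grind
  linarith

end Entropic

section Converse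

variable {F : Type*} [Field F] {n : ℕ}

/-- The coefficients used in the converse: all present links have coefficient `1`, except that the
single cross link of the states `A` and `B` has coefficient `a`. -/
def crossCoeffs (s : ℕ → State) (n : ℕ) (a : F) : Coeffs F n := fun i =>
  match s i with
  | State.A => !![1, a; 0, 1]
  | State.B => !![1, 0; a, 1]
  | State.C => !![1, 1; 1, 1]
  | State.D => !![1, 0; 0, 1]

lemma crossCoeffs_conforms (s : ℕ → State) (n : ℕ) {a : F} (ha : a ≠ 0) :
    (crossCoeffs s n a).Conforms s := by
  intro i r t
  unfold crossCoeffs Linked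
  cases s i <;> fin_cases r <;> fin_cases t <;> simp [ha]

lemma received_crossCoeffs_zero (s : ℕ → State) (a : F) (x : Fin n → Fin 2 → F) (i : Fin n) :
    received (crossCoeffs s n a) x 0 i =
      match s i with
      | State.A => x i 0 + a * x i 1
      | State.B => x i 0
      | State.C => x i 0 + x i 1
      | State.D => x i 0 := by
  unfold received crossCoeffs
  cases s i <;> simp [Fin.sum_univ_two]

lemma received_crossCoeffs_one (s : ℕ → State) (a : F) (x : Fin n → Fin 2 → F) (i : Fin n) :
    received (crossCoeffs s n a) x 1 i =
      match s i with
      | State.A => x i 1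
      | State.B => a * x i 0 + x i 1
      | State.C => x i 0 + x i 1
      | State.D => x i 1 := by
  unfold received crossCoeffs
  cases s i <;> simp [Fin.sum_univ_two]

/-- The number of channel uses among the first `n` that are in state `S`. -/
def stateCount (s : ℕ → State) (S : State) (n : ℕ) : ℕ :=
  ((Finset.range n).filter (fun i => s i = S)).card

lemma card_stateSlots (s : ℕ → State) (S : State) (n : ℕ) :
    Fintype.card {i : Fin n // s i = S} = stateCount s S n := by
  rw [Fintype.card_subtype, stateCount]
  refine Finset.card_bij (fun i _ => (i : ℕ)) (by simp) (fun _ _ _ _ h => Fin.ext h) ?_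
  intro i hi
  rw [Finset.mem_filter, Finset.mem_range] at hi
  exact ⟨⟨i, hi.1⟩, by simpa using hi.2, rfl⟩

lemma card_stateSlots_compl (s : ℕ → State) (S : State) (n : ℕ) :
    (Fintype.card {i : Fin n // s i ≠ S} : ℝ) = n - stateCount s S n := by
  have h := Fintype.card_subtype_compl (fun i : Fin n => s i = S)
  have h' := Fintype.card_subtype_le (fun i : Fin n => s i = S)
  rw [card_stateSlots, Fintype.card_fin] at h h'
  rw [h, Nat.cast_sub h']

lemma entropy_signal_le {Ω F : Type*} [Fintype Ω] [Nonempty Ω] [Fintype F] {ι : Type*} [Fintype ι]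
    (f : Ω → ι → F) : entropy f ≤ Fintype.card ι * Real.log (Fintype.card F) := by
  classical
  refine (entropy_le_log_card f).trans_eq ?_
  rw [Fintype.card_fun, Nat.cast_pow, Real.log_pow]

/-- The converse for a single code of small error probability. -/
lemma Code.two_mul_log_le [Fintype F] (hF : 2 < Fintype.card F) (s : ℕ → State) {M₁ M₂ : ℕ}
    (hM₁ : 0 < M₁) (hM₂ : 0 < M₂) (c : Code F n M₁ M₂) {ε : ℝ}
    (hc : ∀ H : Coeffs F n, H.Conforms s → c.errorProb H ≤ ε) :
    2 * (1 - ε) * (Real.log M₁ + Real.log M₂) ≤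
      (2 * n + stateCount s State.A n + stateCount s State.B n + 2 * stateCount s State.D n)
        * Real.log (Fintype.card F) + 4 * Real.log 2 := by
  classical
  obtain ⟨a, ha0, ha1⟩ : ∃ a : F, a ≠ 0 ∧ a ≠ 1 := by
    by_contra! h
    have : Fintype.card F ≤ ({0, 1} : Finset F).card :=
      Finset.card_le_card fun x _ => by have := h x; grind
    have := Finset.card_le_two (a := (0 : F)) (b := 1)
    omega
  have : NeZero M₁ := ⟨hM₁.ne'⟩
  have : NeZero M₂ := ⟨hM₂.ne'⟩
  let y : F → Fin 2 → Fin M₁ × Fin M₂ → Fin n → F :=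
    fun b r w => received (crossCoeffs s n b) (c.enc w.1 w.2) r
  have hy0 : ∀ b w i, y b 0 w i = _ := fun b w i => received_crossCoeffs_zero s b _ i
  have hy1 : ∀ b w i, y b 1 w i = _ := fun b w i => received_crossCoeffs_one s b _ i
  let X : Fin M₁ × Fin M₂ → {i : Fin n // s i ≠ State.B} → F := fun w i => y 1 1 w i
  let Y : Fin M₁ × Fin M₂ → {i : Fin n // s i ≠ State.A} → F := fun w i => y 1 0 w i
  let l : F → Fin M₁ × Fin M₂ → {i : Fin n // s i = State.A} → F := fun b w i => y b 0 w i
  let m : F → Fin M₁ × Fin M₂ → {i : Fin n // s i = State.B} → F := fun b w i => y b 1 w i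
  let d : Fin 2 → Fin M₁ × Fin M₂ → {i : Fin n // s i = State.D} → F := fun r w i => y 1 r w i
  let g₁ : F → Fin M₁ × Fin M₂ → Fin M₁ := fun b w => c.dec₁ (crossCoeffs s n b) (y b 0 w)
  let g₂ : F → Fin M₁ × Fin M₂ → Fin M₂ := fun b w => c.dec₂ (crossCoeffs s n b) (y b 1 w)
  have hy0_eq : ∀ b w w', Y w = Y w' → l b w = l b w' → y b 0 w = y b 0 w' := by
    intro b w w' h h'
    funext i
    by_cases hi : s i = State.A
    · exact congrFun h' ⟨i, hi⟩
    · have := congrFun h ⟨i, hi⟩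
      simp only [Y, hy0] at this ⊢
      cases hs : s i <;> simp_all
  have hy1_eq : ∀ b w w', X w = X w' → m b w = m b w' → y b 1 w = y b 1 w' := by
    intro b w w' h h'
    funext i
    by_cases hi : s i = State.B
    · exact congrFun h' ⟨i, hi⟩
    · have := congrFun h ⟨i, hi⟩
      simp only [X, hy1] at this ⊢
      cases hs : s i <;> simp_all
  have hE₁ : ∀ b, Function.FactorsThrough Prod.fst
      fun w => ((Y w, l b w), errorVar Prod.fst (g₁ b) w) := by
    intro b w w' h
    simp only [Prod.mk.injEq] at h
    exact eq_of_errorVar_eq (congrArg (c.dec₁ _) (hy0_eq b w w' h.1.1 h.1.2)) h.2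
  have hE₂ : ∀ b, Function.FactorsThrough Prod.snd
      fun w => ((X w, m b w), errorVar Prod.snd (g₂ b) w) := by
    intro b w w' h
    simp only [Prod.mk.injEq] at h
    exact eq_of_errorVar_eq (congrArg (c.dec₂ _) (hy1_eq b w w' h.1.1 h.1.2)) h.2
  -- Two different coefficients of the cross link give both inputs.
  have hsolve : ∀ u v u' v' : F, u + 1 * v = u' + 1 * v' → u + a * v = u' + a * v' → v = v' := by
    intro u v u' v' h h'
    have : (a - 1) * (v - v') = 0 := by linear_combination h' - h
    rcases mul_eq_zero.1 this with h0 | h0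
    · exact absurd (sub_eq_zero.1 h0) ha1
    · exact sub_eq_zero.1 h0
  have hX : X.FactorsThrough fun w => (Y w, l 1 w, l a w, d 1 w) := by
    intro w w' h
    simp only [Prod.mk.injEq] at h
    obtain ⟨h1, h2, h3, h4⟩ := h
    funext ⟨i, hi⟩
    simp only [X, hy1]
    cases hs : s i
    · have h2 := congrFun h2 ⟨i, hs⟩
      have h3 := congrFun h3 ⟨i, hs⟩
      simp only [l, hy0, hs] at h2 h3 ⊢
      exact hsolve _ _ _ _ h2 h3
    · exact absurd hs hi
    · simpa [Y, hy0, hs] using congrFun h1 ⟨i, by simp [hs]⟩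
    · simpa [d, hy1, hs] using congrFun h4 ⟨i, hs⟩
  have hY : Y.FactorsThrough fun w => (X w, m 1 w, m a w, d 0 w) := by
    intro w w' h
    simp only [Prod.mk.injEq] at h
    obtain ⟨h1, h2, h3, h4⟩ := h
    funext ⟨i, hi⟩
    simp only [Y, hy0]
    cases hs : s i
    · exact absurd hs hi
    · have h2 := congrFun h2 ⟨i, hs⟩
      have h3 := congrFun h3 ⟨i, hs⟩
      simp only [m, hy1, hs, add_comm _ (c.enc _ _ _ 1)] at h2 h3 ⊢
      exact hsolve _ _ _ _ h2 h3
    · simpa [X, hy1, hs] using congrFun h1 ⟨i, by simp [hs]⟩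
    · simpa [d, hy0, hs] using congrFun h4 ⟨i, hs⟩
  have herr : ∀ b : F, b ≠ 0 → ∀ P : Fin M₁ × Fin M₂ → Prop,
      (∀ w, P w → g₁ b w ≠ w.1 ∨ g₂ b w ≠ w.2) →
      ({w | P w}.ncard : ℝ) / Fintype.card (Fin M₁ × Fin M₂) ≤ ε := by
    intro b hb P hP
    refine le_trans ?_ (hc _ (crossCoeffs_conforms s n hb))
    unfold Code.errorProb
    rw [Fintype.card_prod, Fintype.card_fin, Fintype.card_fin, Nat.cast_mul]
    gcongr
    · exact Set.toFinite _
    · exact hP _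
  have hE₁_le : ∀ b : F, b ≠ 0 →
      entropy (errorVar Prod.fst (g₁ b)) ≤ Real.log 2 + ε * Real.log M₁ := fun b hb => by
    simpa using entropy_errorVar_le Prod.fst (g₁ b) (herr b hb _ fun w => Or.inl)
  have hE₂_le : ∀ b : F, b ≠ 0 →
      entropy (errorVar Prod.snd (g₂ b)) ≤ Real.log 2 + ε * Real.log M₂ := fun b hb => by
    simpa using entropy_errorVar_le Prod.snd (g₂ b) (herr b hb _ fun w => Or.inr)
  have key := two_mul_log_card_le (d 0) (d 1) (fun _ _ h => h) (hE₁ 1) (hE₁ a) (hE₂ 1) (hE₂ a)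
    hX hY
  have hXle := entropy_signal_le X
  have hYle := entropy_signal_le Y
  have hl := fun b => entropy_signal_le (l b)
  have hm := fun b => entropy_signal_le (m b)
  have hd := fun r => entropy_signal_le (d r)
  rw [card_stateSlots_compl] at hXle hYle
  simp only [card_stateSlots] at hl hm hd
  rw [Fintype.card_prod, Fintype.card_fin, Fintype.card_fin, Nat.cast_mul,
    Real.log_mul (by positivity) (by positivity)] at key
  linarith [hl 1, hl a, hm 1, hm a, hd 0, hd 1, hE₁_le 1 one_ne_zero, hE₁_le a ha0,
    hE₂_le 1 one_ne_zero, hE₂_le a ha0]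

lemma Achievable.add_le [Fintype F] (hF : 2 < Fintype.card F) {s : ℕ → State} {lam : State → ℝ}
    (hlam : ∀ S, HasFraction s S (lam S)) {R₁ R₂ : ℝ} (h : Achievable F s R₁ R₂) :
    2 * (R₁ + R₂) ≤ 2 + lam State.A + lam State.B + 2 * lam State.D := by
  obtain ⟨-, -, h⟩ := h
  have hq : (1 : ℝ) < Fintype.card F := by exact_mod_cast (by omega : 1 < Fintype.card F)
  have hL : 0 < Real.log (Fintype.card F) := Real.log_pos hq
  have hε : ∀ ε : ℝ, 0 < ε → ε < 1 →
      2 * (1 - ε) * (R₁ + R₂) ≤ 2 + lam State.A + lam State.B + 2 * lam State.D := by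
    intro ε hε hε1
    have hlim : Tendsto (fun n : ℕ => 2 + (stateCount s State.A n : ℝ) / n
        + (stateCount s State.B n : ℝ) / n + 2 * ((stateCount s State.D n : ℝ) / n)
        + 4 * Real.log 2 / Real.log (Fintype.card F) / n) atTop
        (𝓝 (2 + lam State.A + lam State.B + 2 * lam State.D + 0)) :=
      (((tendsto_const_nhds.add (hlam State.A)).add (hlam State.B)).add
        ((hlam State.D).const_mul 2)).add (tendsto_const_div_atTop_nhds_zero_nat _)
    rw [add_zero] at hlim
    refine ge_of_tendsto hlim ?_
    filter_upwards [h ε hε, eventually_gt_atTop 0] with n ⟨M₁, M₂, c, h1, h2, hc⟩ hn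
    have hn' : (0 : ℝ) < n := by exact_mod_cast hn
    have hp : ∀ R : ℝ, 0 < (Fintype.card F : ℝ) ^ ((n : ℝ) * R) :=
      fun R => Real.rpow_pos_of_pos (by linarith) _
    have hlog : ∀ {R : ℝ} {M : ℕ}, (Fintype.card F : ℝ) ^ ((n : ℝ) * R) ≤ M →
        n * R * Real.log (Fintype.card F) ≤ Real.log M := fun {R M} hM => by
      rw [← Real.log_rpow (by linarith)]
      exact Real.log_le_log (hp R) hM
    have hb := c.two_mul_log_le hF s (by exact_mod_cast (hp _).trans_le h1)
      (by exact_mod_cast (hp _).trans_le h2) hc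
    have hmul := mul_le_mul_of_nonneg_left (add_le_add (hlog h1) (hlog h2))
      (by linarith : 0 ≤ 2 * (1 - ε))
    have hfin := hmul.trans hb
    rw [← sub_nonneg] at hfin ⊢
    refine (div_nonneg hfin (mul_pos hn' hL).le).trans_eq ?_
    field_simp
  have hlim : Tendsto (fun ε : ℝ => 2 * (1 - ε) * (R₁ + R₂)) (𝓝[>] 0)
      (𝓝 (2 * (1 - 0) * (R₁ + R₂))) :=
    Continuous.tendsto (by fun_prop) 0 |>.mono_left nhdsWithin_le_nhds
  have := le_of_tendsto hlim (by
    filter_upwards [Ioo_mem_nhdsGT (zero_lt_one (α := ℝ))] with ε hx using hε ε hx.1 hx.2)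
  linarith

end Converse

/-! ### Achievability -/

section Achievability

variable {F : Type*} [Field F] {n : ℕ}

/-- An encoder from which both receivers can determine their messages, for all conforming
coefficients, gives a code without errors. The decoders pick any message pair that explains the
received signal. -/
lemma exists_code_errorProb_eq_zero (s : ℕ → State) {U₁ U₂ : Type*} [Fintype U₁] [Fintype U₂]
    [Nonempty U₁] [Nonempty U₂] (enc : U₁ → U₂ → Fin n → Fin 2 → F)
    (h₁ : ∀ H : Coeffs F n, H.Conforms s → ∀ u₁ u₂ u₁' u₂',
      received H (enc u₁ u₂) 0 = received H (enc u₁' u₂') 0 → u₁ = u₁')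
    (h₂ : ∀ H : Coeffs F n, H.Conforms s → ∀ u₁ u₂ u₁' u₂',
      received H (enc u₁ u₂) 1 = received H (enc u₁' u₂') 1 → u₂ = u₂') :
    ∃ c : Code F n (Fintype.card U₁) (Fintype.card U₂), ∀ H : Coeffs F n, H.Conforms s →
      c.errorProb H = 0 := by
  classical
  let e₁ := Fintype.equivFin U₁
  let e₂ := Fintype.equivFin U₂
  let explain : Fin 2 → Coeffs F n → (Fin n → F) → U₁ × U₂ := fun r H =>
    Function.invFun fun u => received H (enc u.1 u.2) r
  refine ⟨⟨fun w₁ w₂ => enc (e₁.symm w₁) (e₂.symm w₂), fun H y => e₁ (explain 0 H y).1,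
    fun H y => e₂ (explain 1 H y).2⟩, fun H hH => ?_⟩
  have hexp : ∀ r u₁ u₂, received H (enc (explain r H (received H (enc u₁ u₂) r)).1
      (explain r H (received H (enc u₁ u₂) r)).2) r = received H (enc u₁ u₂) r := fun r u₁ u₂ =>
    Function.invFun_eq (f := fun u : U₁ × U₂ => received H (enc u.1 u.2) r) ⟨(u₁, u₂), rfl⟩
  have hd₁ : ∀ u₁ u₂, (explain 0 H (received H (enc u₁ u₂) 0)).1 = u₁ := fun u₁ u₂ =>
    h₁ H hH _ _ _ _ (hexp 0 u₁ u₂)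
  have hd₂ : ∀ u₁ u₂, (explain 1 H (received H (enc u₁ u₂) 1)).2 = u₂ := fun u₁ u₂ =>
    h₂ H hH _ _ _ _ (hexp 1 u₁ u₂)
  simp [Code.errorProb, hd₁, hd₂]

/-- The scheme that serves `k` pairs of a channel use in state `A` and one in state `B`, here at the
times `σ j` and `τ j`. In state `A` a symbol `u` for receiver 1 and a symbol `v` for receiver 2 are
sent, so receiver 2 finds `v` and receiver 1 sees a mixture; in state `B` transmitter 1 repeats `v`,
which resolves the mixture at receiver 1 and is known interference for receiver 2, to which
transmitter 2 sends a further symbol `v'`. State `C` serves receiver 1 alone, state `D` both. -/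
noncomputable def pairEnc (s : ℕ → State) {k : ℕ} (σ τ : Fin k → Fin n)
    (w₁ : (Fin k → F) × ({i : Fin n // s i = State.C} → F) × ({i : Fin n // s i = State.D} → F))
    (w₂ : (Fin k → F) × (Fin k → F) × ({i : Fin n // s i = State.D} → F)) :
    Fin n → Fin 2 → F := fun i =>
  match s i with
  | State.A => ![Function.extend σ w₁.1 0 i, Function.extend σ w₂.1 0 i]
  | State.B => ![Function.extend τ w₂.1 0 i, Function.extend τ w₂.2.1 0 i]
  | State.C => ![Function.extend Subtype.val w₁.2.1 0 i, 0]
  | State.D => ![Function.extend Subtype.val w₁.2.2 0 i, Function.extend Subtype.val w₂.2.2 0 i]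

/-- Both receivers can decode the pairing scheme, whatever the coefficients. -/
lemma exists_pairing_code [Fintype F] (s : ℕ → State) {k : ℕ} (hA : k ≤ stateCount s State.A n)
    (hB : k ≤ stateCount s State.B n) :
    ∃ c : Code F n (Fintype.card F ^ (k + stateCount s State.C n + stateCount s State.D n))
        (Fintype.card F ^ (2 * k + stateCount s State.D n)),
      ∀ H : Coeffs F n, H.Conforms s → c.errorProb H = 0 := by
  classical
  have hemb : ∀ S, k ≤ stateCount s S n → ∃ σ : Fin k → Fin n, σ.Injective ∧ ∀ j, s (σ j) = S := by
    intro S hS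
    rw [← card_stateSlots, ← Fintype.card_fin k] at hS
    obtain ⟨f⟩ := Function.Embedding.nonempty_of_card_le hS
    exact ⟨fun j => f j, fun a b h => f.injective (Subtype.ext h), fun j => (f j).2⟩
  obtain ⟨σ, hσ, hσA⟩ := hemb _ hA
  obtain ⟨τ, hτ, hτB⟩ := hemb _ hB
  have hcard₁ : Fintype.card ((Fin k → F) × ({i : Fin n // s i = State.C} → F) ×
      ({i : Fin n // s i = State.D} → F)) =
      Fintype.card F ^ (k + stateCount s State.C n + stateCount s State.D n) := by
    simp only [Fintype.card_prod, Fintype.card_fun, card_stateSlots, Fintype.card_fin]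
    ring
  have hcard₂ : Fintype.card ((Fin k → F) × (Fin k → F) × ({i : Fin n // s i = State.D} → F)) =
      Fintype.card F ^ (2 * k + stateCount s State.D n) := by
    simp only [Fintype.card_prod, Fintype.card_fun, card_stateSlots, Fintype.card_fin]
    ring
  rw [← hcard₁, ← hcard₂]
  refine exists_code_errorProb_eq_zero s (pairEnc s σ τ) ?_ ?_
  · rintro H hH ⟨u, c, d⟩ ⟨v, v', d'⟩ ⟨u₁, c₁, d₁⟩ ⟨v₁, v₁', d₁'⟩ h
    have hv : v = v₁ := funext fun j => by
      have := congrFun h (τ j)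
      have h00 : H (τ j) 0 0 ≠ 0 := (hH _ _ _).2 (by simp [Linked])
      have h01 : H (τ j) 0 1 = 0 :=
        by_contra fun hne => by simpa [Linked, hτB] using (hH _ _ _).1 hne
      simpa [received, pairEnc, hτB, Fin.sum_univ_two, h01, h00, hτ.extend_apply] using this
    subst hv
    refine Prod.ext (funext fun j => ?_) (Prod.ext (funext fun i => ?_) (funext fun i => ?_))
    · have := congrFun h (σ j)
      have h00 : H (σ j) 0 0 ≠ 0 := (hH _ _ _).2 (by simp [Linked])
      simpa [received, pairEnc, hσA, Fin.sum_univ_two, h00, hσ.extend_apply] using this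
    · have := congrFun h i
      have h00 : H i 0 0 ≠ 0 := (hH _ _ _).2 (by simp [Linked])
      simpa [received, pairEnc, i.2, Fin.sum_univ_two, h00, Subtype.val_injective.extend_apply]
        using this
    · have := congrFun h i
      have h00 : H i 0 0 ≠ 0 := (hH _ _ _).2 (by simp [Linked])
      have h01 : H i 0 1 = 0 :=
        by_contra fun hne => by simpa [Linked, i.2] using (hH _ _ _).1 hne
      simpa [received, pairEnc, i.2, Fin.sum_univ_two, h00, h01, Subtype.val_injective.extend_apply]
        using this
  · rintro H hH ⟨u, c, d⟩ ⟨v, v', d'⟩ ⟨u₁, c₁, d₁⟩ ⟨v₁, v₁', d₁'⟩ h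
    have hv : v = v₁ := funext fun j => by
      have := congrFun h (σ j)
      have h11 : H (σ j) 1 1 ≠ 0 := (hH _ _ _).2 (by simp [Linked])
      have h10 : H (σ j) 1 0 = 0 :=
        by_contra fun hne => by simpa [Linked, hσA] using (hH _ _ _).1 hne
      simpa [received, pairEnc, hσA, Fin.sum_univ_two, h10, h11, hσ.extend_apply] using this
    subst hv
    refine Prod.ext rfl (Prod.ext (funext fun j => ?_) (funext fun i => ?_))
    · have := congrFun h (τ j)
      have h11 : H (τ j) 1 1 ≠ 0 := (hH _ _ _).2 (by simp [Linked])
      simpa [received, pairEnc, hτB, Fin.sum_univ_two, h11, hτ.extend_apply] using this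
    · have := congrFun h i
      have h11 : H i 1 1 ≠ 0 := (hH _ _ _).2 (by simp [Linked])
      have h10 : H i 1 0 = 0 :=
        by_contra fun hne => by simpa [Linked, i.2] using (hH _ _ _).1 hne
      simpa [received, pairEnc, i.2, Fin.sum_univ_two, h10, h11, Subtype.val_injective.extend_apply]
        using this

lemma HasFraction.nonneg {s : ℕ → State} {S : State} {l : ℝ} (h : HasFraction s S l) : 0 ≤ l :=
  ge_of_tendsto' h fun _ => by positivity

lemma sum_fractions {s : ℕ → State} {lam : State → ℝ} (hlam : ∀ S, HasFraction s S (lam S)) :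
    lam State.A + lam State.B + lam State.C + lam State.D = 1 := by
  have h := (((hlam State.A).add (hlam State.B)).add (hlam State.C)).add (hlam State.D)
  refine tendsto_nhds_unique h (tendsto_const_nhds.congr' ?_)
  filter_upwards [eventually_gt_atTop 0] with n hn
  have hn' : (n : ℝ) ≠ 0 := by exact_mod_cast hn.ne'
  have hcount : ∀ N, stateCount s State.A N + stateCount s State.B N + stateCount s State.C N
      + stateCount s State.D N = N := by
    intro N
    simp only [stateCount, Finset.card_filter, ← Finset.sum_add_distrib]
    rw [Finset.sum_congr rfl (g := fun _ => 1) fun i _ => by cases s i <;> rfl]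
    simp
  rw [← add_div, ← add_div, ← add_div, eq_comm, div_eq_one_iff_eq hn']
  exact_mod_cast hcount n

/-- For `δ < 1` a sequence `a n / n` with limit `r` is eventually at least `δ r`; for `r = 0` the
bound is trivial. -/
lemma eventually_mul_le_of_tendsto {a : ℕ → ℕ} {r δ : ℝ}
    (h : Tendsto (fun n => (a n : ℝ) / n) atTop (𝓝 r)) (hδ : δ < 1) :
    ∀ᶠ n : ℕ in atTop, (n : ℝ) * (δ * r) ≤ a n := by
  have hr : 0 ≤ r := ge_of_tendsto' h fun _ => by positivity
  rcases hr.eq_or_lt with rfl | hr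
  · simp
  · filter_upwards [h.eventually (lt_mem_nhds (by nlinarith : δ * r < r)), eventually_gt_atTop 0]
      with n hn hn0
    rw [lt_div_iff₀ (by exact_mod_cast hn0)] at hn
    linarith

lemma achievable_pairing [Fintype F] (hF : 2 < Fintype.card F) {s : ℕ → State} {lam : State → ℝ}
    (hlam : ∀ S, HasFraction s S (lam S)) (hsymm : lam State.A = lam State.B) {δ : ℝ}
    (hδ0 : 0 ≤ δ) (hδ : δ < 1) :
    Achievable F s (δ * (lam State.A + lam State.C + lam State.D))
      (δ * (2 * lam State.A + lam State.D)) := by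
  have hA := (hlam State.A).nonneg
  have hC := (hlam State.C).nonneg
  have hD := (hlam State.D).nonneg
  refine ⟨by positivity, by positivity, fun ε hε => ?_⟩
  let k : ℕ → ℕ := fun n => min (stateCount s State.A n) (stateCount s State.B n)
  have hk : Tendsto (fun n => (k n : ℝ) / n) atTop (𝓝 (lam State.A)) := by
    have h := (hlam State.A).min (hlam State.B)
    rw [← hsymm, min_self] at h
    refine h.congr fun n => ?_
    rw [min_div_div_right (Nat.cast_nonneg n), ← Nat.cast_min]
    rfl
  have h1 : Tendsto (fun n => ((k n + stateCount s State.C n + stateCount s State.D n : ℕ) : ℝ) / n)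
      atTop (𝓝 (lam State.A + lam State.C + lam State.D)) := by
    refine ((hk.add (hlam State.C)).add (hlam State.D)).congr fun n => ?_
    simp only [stateCount]
    push_cast
    ring
  have h2 : Tendsto (fun n => ((2 * k n + stateCount s State.D n : ℕ) : ℝ) / n)
      atTop (𝓝 (2 * lam State.A + lam State.D)) := by
    refine ((hk.const_mul 2).add (hlam State.D)).congr fun n => ?_
    simp only [stateCount]
    push_cast
    ring
  have hq : (1 : ℝ) ≤ Fintype.card F := by exact_mod_cast (by omega : 1 ≤ Fintype.card F)
  have hpow : ∀ {x : ℝ} {N : ℕ}, x ≤ N →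
      (Fintype.card F : ℝ) ^ x ≤ ((Fintype.card F ^ N : ℕ) : ℝ) := fun {x N} hx => by
    rw [Nat.cast_pow, ← Real.rpow_natCast]
    exact Real.rpow_le_rpow_of_exponent_le hq hx
  filter_upwards [eventually_mul_le_of_tendsto h1 hδ, eventually_mul_le_of_tendsto h2 hδ]
    with n hn1 hn2
  obtain ⟨c, hc⟩ := exists_pairing_code (F := F) (n := n) s (min_le_left _ _) (min_le_right _ _)
  exact ⟨_, _, c, hpow hn1, hpow hn2, fun H hH => (hc H hH).trans_le hε.le⟩

end Achievability

end AltBC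

theorem theorem3 {F : Type*} [Field F] [Fintype F] (hF : 2 < Fintype.card F)
    (s : ℕ → AltBC.State) (lam : AltBC.State → ℝ)
    (hlam : ∀ S : AltBC.State, AltBC.HasFraction s S (lam S))
    (hsymm : lam AltBC.State.A = lam AltBC.State.B) :
    AltBC.IsSumCapacity F s (1 + lam AltBC.State.A + lam AltBC.State.D) := by
  have hsum := AltBC.sum_fractions hlam
  constructor
  · rintro R ⟨R₁, R₂, hR, rfl⟩
    have := hR.add_le hF hlam
    linarith
  · intro b hb
    have hlim : Tendsto (fun δ : ℝ => δ * (1 + lam AltBC.State.A + lam AltBC.State.D)) (𝓝[<] 1)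
        (𝓝 (1 * (1 + lam AltBC.State.A + lam AltBC.State.D))) :=
      (Continuous.tendsto (by fun_prop) 1).mono_left nhdsWithin_le_nhds
    rw [one_mul] at hlim
    refine le_of_tendsto hlim ?_
    filter_upwards [Ioo_mem_nhdsLT (zero_lt_one (α := ℝ))] with δ hδ
    refine hb ⟨_, _, AltBC.achievable_pairing hF hlam hsymm hδ.1.le hδ.2, ?_⟩
    linear_combination δ * (-hsum - hsymm)
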